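/- Let $n\ge 0$ and let $\mathbb S^n$ be the space of real symmetric $n\times n$ matrices with $\langle X,Y\rangle=\mathrm{Tr}(XY)$. For a function $f$ on $\mathbb R$ and $X=U\,\mathrm{Diag}(\lambda_1,\dots,\lambda_n)U^\top\in\mathbb S^n$ with $U$ orthogonal, the matrix extension of $f$ at $X$ is $U\,\mathrm{Diag}(f(\lambda_1),\dots,f(\lambda_n))U^\top$. Let $qe(X)=\mathrm{Tr}(X\ln X)$ be the trace of the matrix extension of $f(x)=x\ln x$ at $X$ (with $0\ln 0=0$, and $qe(X)=+\infty$ if $X$ has a negative eigenvalue). For $(t,X)\in\mathbb R\times\mathbb S^n$ let $$\Phi(t,X)=-\ln\bigl(t-qe(X)\bigr)-\ln\det X,$$ where $-\ln s=+\infty$ for $s\le 0$ (including $s=-\infty$), so that $\Phi$ is finite exactly when $X$ is positive definite and $t>qe(X)$. Let $$\Phi_*(\eta,Y)=\sup_{t\in\mathbb R,\;X\in\mathbb S^n}\bigl\{t\eta+\langle X,Y\rangle-\Phi(t,X)\bigr\}\in[-\infty,+\infty]$$ be its Legendre–Fenchel conjugate. For $r\in\mathbb R$ let $\theta(r)$ be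 the unique $\theta>0$ with $\frac1\theta-\ln\theta=r$. Then for every real $\eta<0$ and every $Y\in\mathbb S^n$, the matrix extension $\Theta$ of the function $\theta$ at $\frac1\eta Y+(1-\ln(-\eta))I$ is invertible, and $$\Phi_*(\eta,Y)=-\ln(-\eta)+\mathrm{Tr}\bigl(\Theta+\Theta^{-1}\bigr)-\mathrm{Tr}\Bigl(\frac1\eta Y\Bigr)-1-2n .$$ -/

import Mathlib

noncomputable section

/-- `Sⁿ`: the real symmetric `n × n` matrices (for real matrices, self-adjoint means symmetric). -/
abbrev SymMat (n : ℕ) : Type := selfAdjoint (Matrix (Fin n) (Fin n) ℝ)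

/-- The matrix underlying an element of `SymMat n` is Hermitian. -/
theorem SymMat.isHermitian {n : ℕ} (X : SymMat n) :
    (X : Matrix (Fin n) (Fin n) ℝ).IsHermitian :=
  selfAdjoint.mem_iff.mp X.2

/-- Matrix extension of a real function `f`: if `X = U Diag(λ₁, …, λₙ) Uᵀ` is a spectral
decomposition, then `F(X) = U Diag(f λ₁, …, f λₙ) Uᵀ`. -/
def matExt {n : ℕ} (f : ℝ → ℝ) (X : SymMat n) : Matrix (Fin n) (Fin n) ℝ :=
  (X.isHermitian.eigenvectorUnitary : Matrix (Fin n) (Fin n) ℝ) *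
    Matrix.diagonal (fun i => f (X.isHermitian.eigenvalues i)) *
    (star X.isHermitian.eigenvectorUnitary : Matrix (Fin n) (Fin n) ℝ)

open Classical in
/-- `φ(X) = Tr F(X)` for an extended real valued `f`, with the value `+∞` as soon as `f` is not
real at some eigenvalue of `X`. -/
def traceExt {n : ℕ} (f : ℝ → EReal) (X : SymMat n) : EReal :=
  if ∀ i, f (X.isHermitian.eigenvalues i) ≠ ⊤ ∧ f (X.isHermitian.eigenvalues i) ≠ ⊥ then
    (((matExt (fun x => (f x).toReal) X).trace : ℝ) : EReal)
  else ⊤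

/-- The function `x ln x` (with `0 ln 0 = 0`), extended by `+∞` to negative `x`. -/
def xlnx (x : ℝ) : EReal :=
  if 0 ≤ x then ((x * Real.log x : ℝ) : EReal) else ⊤

/-- The quantum (von Neumann) entropy `qe(X) = Tr (X ln X)`. -/
def qe {n : ℕ} (X : SymMat n) : EReal := traceExt xlnx X

/-- The extended logarithm: `ln x` for `0 < x < ∞`, the value `-∞` for `x ≤ 0`, and
`ln (+∞) = +∞`. -/
def extLn (x : EReal) : EReal := ENNReal.log x.toENNReal

/-- The barrier `Φ(t, X) = - ln (t - Tr (X ln X)) - ln det X`, with value `+∞` where one of the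
logarithms is not defined. -/
def qeBarrier {n : ℕ} (t : ℝ) (X : SymMat n) : EReal :=
  -extLn ((t : EReal) - qe X) - extLn (((X : Matrix (Fin n) (Fin n) ℝ).det : ℝ) : EReal)

/-- The Legendre–Fenchel conjugate `Φ_*(η, Y) = sup_{t, X} (t η + ⟨X, Y⟩ - Φ(t, X))` of an
extended real valued function on `ℝ ⊕ Sⁿ`, where `⟨X, Y⟩ = Tr (X Y)`. -/
def lfConj {n : ℕ} (Φ : ℝ → SymMat n → EReal) (η : ℝ) (Y : SymMat n) : EReal :=
  ⨆ (t : ℝ) (X : SymMat n),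
    ((t * η + ((X : Matrix (Fin n) (Fin n) ℝ) * (Y : Matrix (Fin n) (Fin n) ℝ)).trace : ℝ) : EReal)
      - Φ t X

/-- The equation `1/θ - ln θ = r` has exactly one solution `θ > 0`, for every real `r`. -/
theorem existsUnique_theta (r : ℝ) : ∃! θ : ℝ, 0 < θ ∧ 1 / θ - Real.log θ = r := by
  have hmono : StrictMono (fun u : ℝ => Real.exp u + u) := Real.exp_strictMono.add strictMono_id
  have hcont : ContinuousOn (fun u : ℝ => Real.exp u + u) (Set.Icc (r - Real.exp r) r) := by
    fun_prop
  have hle : r - Real.exp r ≤ r := by linarith [Real.exp_pos r]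
  have hmem : r ∈ Set.Icc (Real.exp (r - Real.exp r) + (r - Real.exp r)) (Real.exp r + r) := by
    constructor
    · linarith [Real.exp_le_exp.mpr hle]
    · linarith [Real.exp_pos r]
  obtain ⟨u, -, hu⟩ := intermediate_value_Icc hle hcont hmem
  refine ⟨Real.exp (-u), ⟨Real.exp_pos _, ?_⟩, ?_⟩
  · simp only [Real.log_exp, one_div, ← Real.exp_neg, neg_neg, sub_neg_eq_add]
    exact hu
  · rintro y ⟨hy, hyr⟩
    have h : Real.exp (-Real.log y) + (-Real.log y) = r := by
      rw [Real.exp_neg, Real.exp_log hy, ← one_div]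
      linarith
    have h2 : -Real.log y = u := hmono.injective (h.trans hu.symm)
    rw [← h2, neg_neg, Real.exp_log hy]

/-- `θ(r)`: the unique positive solution of `1/θ - ln θ = r`. -/
def theta (r : ℝ) : ℝ := (existsUnique_theta r).choose

theorem theta_spec (r : ℝ) : 0 < theta r ∧ 1 / theta r - Real.log (theta r) = r :=
  (existsUnique_theta r).choose_spec.1

/-- The matrix `Θ`: the matrix extension of `θ` at `Y/η + (1 - ln(-η)) I`. -/
def bigTheta {n : ℕ} (η : ℝ) (Y : SymMat n) : Matrix (Fin n) (Fin n) ℝ :=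
  matExt theta ((1 / η) • Y + (1 - Real.log (-η)) • (1 : SymMat n))

end

/-! ### Matrix extensions -/

theorem trace_matExt {n : ℕ} (f : ℝ → ℝ) (X : SymMat n) :
    (matExt f X).trace = ∑ i, f (X.isHermitian.eigenvalues i) := by
  rw [matExt, Matrix.trace_mul_cycle]
  simp

theorem matExt_mul {n : ℕ} (f g : ℝ → ℝ) (X : SymMat n) :
    matExt f X * matExt g X = matExt (fun x => f x * g x) X := by
  simp only [matExt]
  set U := X.isHermitian.eigenvectorUnitary
  have hU : (star U : Matrix (Fin n) (Fin n) ℝ) * (U : Matrix (Fin n) (Fin n) ℝ) = 1 :=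
    Unitary.coe_star_mul_self U
  rw [← Matrix.diagonal_mul_diagonal]
  simp only [Matrix.mul_assoc]
  rw [← Matrix.mul_assoc (star U : Matrix (Fin n) (Fin n) ℝ), hU, Matrix.one_mul]

theorem matExt_id {n : ℕ} (X : SymMat n) : matExt (fun x => x) X = X :=
  X.isHermitian.spectral_theorem.symm

theorem matExt_one {n : ℕ} (X : SymMat n) : matExt (fun _ => 1) X = 1 := by
  simp [matExt]

theorem isSelfAdjoint_matExt {n : ℕ} (f : ℝ → ℝ) (X : SymMat n) :
    matExt f X ∈ selfAdjoint (Matrix (Fin n) (Fin n) ℝ) := by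
  rw [selfAdjoint.mem_iff]
  simp [matExt, star_mul, Matrix.star_eq_conjTranspose, Matrix.mul_assoc]

/-- The matrix extension as a symmetric matrix. -/
noncomputable def symMatExt {n : ℕ} (f : ℝ → ℝ) (X : SymMat n) : SymMat n :=
  ⟨matExt f X, isSelfAdjoint_matExt f X⟩

/-- The eigenvalues of `F(X)` are, up to order, the values of `f` at the eigenvalues of `X`. -/
theorem map_eigenvalues_symMatExt {n : ℕ} (f : ℝ → ℝ) (X : SymMat n) :
    Multiset.map (symMatExt f X).isHermitian.eigenvalues Finset.univ.val =
      Multiset.map (fun i => f (X.isHermitian.eigenvalues i)) Finset.univ.val := by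
  have h₁ := (symMatExt f X).isHermitian.roots_charpoly_eq_eigenvalues
  have h₂ : ((symMatExt f X : SymMat n) : Matrix (Fin n) (Fin n) ℝ).charpoly =
      ∏ i, (Polynomial.X - Polynomial.C (f (X.isHermitian.eigenvalues i))) := by
    change (matExt f X).charpoly = _
    rw [matExt, Matrix.charpoly_mul_comm, ← Matrix.mul_assoc, Unitary.coe_star_mul_self,
      Matrix.one_mul, Matrix.charpoly_diagonal]
  have h₃ : (∏ i, (Polynomial.X - Polynomial.C (f (X.isHermitian.eigenvalues i)))).roots =
      Multiset.map (fun i => f (X.isHermitian.eigenvalues i)) Finset.univ.val := by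
    rw [Polynomial.roots_prod _ _
      (Finset.prod_ne_zero_iff.mpr fun i _ => Polynomial.X_sub_C_ne_zero _)]
    simp
  rw [h₂, h₃] at h₁
  exact h₁.symm

theorem sum_eigenvalues_symMatExt {n : ℕ} (f g : ℝ → ℝ) (X : SymMat n) :
    ∑ i, g ((symMatExt f X).isHermitian.eigenvalues i) =
      ∑ i, g (f (X.isHermitian.eigenvalues i)) := by
  have h := congrArg (fun s => (Multiset.map g s).sum) (map_eigenvalues_symMatExt f X)
  simp only [Multiset.map_map] at h
  exact h

theorem eigenvalues_symMatExt_pos {n : ℕ} {f : ℝ → ℝ} (hf : ∀ x, 0 < f x) (X : SymMat n)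
    (i : Fin n) : 0 < (symMatExt f X).isHermitian.eigenvalues i := by
  have h : (symMatExt f X).isHermitian.eigenvalues i ∈
      Multiset.map (symMatExt f X).isHermitian.eigenvalues Finset.univ.val :=
    Multiset.mem_map_of_mem _ (Finset.mem_univ_val i)
  rw [map_eigenvalues_symMatExt, Multiset.mem_map] at h
  obtain ⟨j, -, hj⟩ := h
  exact hj ▸ hf _

/-- The trace of a product of two symmetric matrices in terms of their eigenvalues and a doubly
stochastic matrix of weights. -/
theorem exists_doublyStochastic_trace_mul {n : ℕ} (X Z : SymMat n) :
    ∃ W ∈ doublyStochastic ℝ (Fin n),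
      ((X : Matrix (Fin n) (Fin n) ℝ) * (Z : Matrix (Fin n) (Fin n) ℝ)).trace =
        ∑ i, ∑ j, W i j * (X.isHermitian.eigenvalues i * Z.isHermitian.eigenvalues j) := by
  set U := X.isHermitian.eigenvectorUnitary with hUdef
  set V := Z.isHermitian.eigenvectorUnitary with hVdef
  set A : Matrix (Fin n) (Fin n) ℝ :=
    ((star U * V : Matrix.unitaryGroup (Fin n) ℝ) : Matrix (Fin n) (Fin n) ℝ) with hA
  have h₁ : A * star A = 1 := Unitary.coe_mul_star_self (star U * V)
  have h₂ : star A * A = 1 := Unitary.coe_star_mul_self (star U * V)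
  refine ⟨Matrix.of fun i j => A i j ^ 2, ?_, ?_⟩
  · rw [mem_doublyStochastic_iff_sum]
    refine ⟨fun i j => sq_nonneg _, fun i => ?_, fun j => ?_⟩
    · have := congrFun (congrFun h₁ i) i
      simpa [Matrix.mul_apply, Matrix.star_eq_conjTranspose, sq] using this
    · have := congrFun (congrFun h₂ j) j
      simpa [Matrix.mul_apply, Matrix.star_eq_conjTranspose, sq] using this
  · have h : ((X : Matrix (Fin n) (Fin n) ℝ) * (Z : Matrix (Fin n) (Fin n) ℝ)).trace =
        (Matrix.diagonal X.isHermitian.eigenvalues * A *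
          (Matrix.diagonal Z.isHermitian.eigenvalues * star A)).trace := by
      conv_lhs => rw [← matExt_id X, ← matExt_id Z]
      simp only [matExt, ← hUdef, ← hVdef]
      rw [Matrix.mul_assoc, Matrix.mul_assoc, Matrix.trace_mul_comm]
      simp only [hA, Matrix.mul_assoc, Submonoid.coe_mul, Unitary.coe_star, star_mul, star_star]
    rw [h]
    simp only [Matrix.trace, Matrix.diag, Matrix.mul_apply (M := _ * A), Matrix.diagonal_mul,
      Matrix.star_eq_conjTranspose, Matrix.conjTranspose_apply, star_trivial]
    refine Finset.sum_congr rfl fun i _ => Finset.sum_congr rfl fun j _ => ?_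
    rw [Matrix.of_apply]
    ring

/-! ### The barrier -/

theorem extLn_coe_of_pos {x : ℝ} (hx : 0 < x) : extLn (x : EReal) = (Real.log x : ℝ) := by
  simp [extLn, ENNReal.log_ofReal, hx.not_ge]

theorem extLn_of_nonpos {x : EReal} (hx : x ≤ 0) : extLn x = ⊥ := by
  simp [extLn, EReal.toENNReal_of_nonpos hx]

theorem qe_of_nonneg {n : ℕ} {X : SymMat n} (hX : ∀ i, 0 ≤ X.isHermitian.eigenvalues i) :
    qe X = ((∑ i, X.isHermitian.eigenvalues i * Real.log (X.isHermitian.eigenvalues i) : ℝ) :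
      EReal) := by
  have h : ∀ i, xlnx (X.isHermitian.eigenvalues i) =
      ((X.isHermitian.eigenvalues i * Real.log (X.isHermitian.eigenvalues i) : ℝ) : EReal) :=
    fun i => if_pos (hX i)
  rw [qe, traceExt, if_pos fun i => by rw [h]; exact ⟨EReal.coe_ne_top _, EReal.coe_ne_bot _⟩,
    trace_matExt]
  simp only [h, EReal.toReal_coe]

theorem qe_of_neg {n : ℕ} {X : SymMat n} {i : Fin n} (hX : X.isHermitian.eigenvalues i < 0) :
    qe X = ⊤ := by
  rw [qe, traceExt, if_neg]
  intro h
  exact (h i).1 (if_neg hX.not_ge)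

theorem log_det_eq_sum {n : ℕ} {X : SymMat n} (hX : ∀ i, 0 < X.isHermitian.eigenvalues i) :
    Real.log (X : Matrix (Fin n) (Fin n) ℝ).det =
      ∑ i, Real.log (X.isHermitian.eigenvalues i) := by
  rw [X.isHermitian.det_eq_prod_eigenvalues]
  exact Real.log_prod fun i _ => (hX i).ne'

/-- The barrier on its domain. -/
theorem qeBarrier_of_pos {n : ℕ} {t : ℝ} {X : SymMat n}
    (hX : ∀ i, 0 < X.isHermitian.eigenvalues i)
    (ht : ∑ i, X.isHermitian.eigenvalues i * Real.log (X.isHermitian.eigenvalues i) < t) :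
    qeBarrier t X =
      ((-Real.log (t - ∑ i, X.isHermitian.eigenvalues i * Real.log (X.isHermitian.eigenvalues i))
        - ∑ i, Real.log (X.isHermitian.eigenvalues i) : ℝ) : EReal) := by
  have hdet : 0 < (X : Matrix (Fin n) (Fin n) ℝ).det := by
    rw [X.isHermitian.det_eq_prod_eigenvalues]
    exact Finset.prod_pos fun i _ => hX i
  rw [qeBarrier, qe_of_nonneg fun i => (hX i).le, ← EReal.coe_sub,
    extLn_coe_of_pos (sub_pos.mpr ht), extLn_coe_of_pos hdet, log_det_eq_sum hX]
  push_cast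
  rfl

theorem extLn_coe_ne_top (x : ℝ) : extLn (x : EReal) ≠ ⊤ := by
  rw [extLn, Ne, ENNReal.log_eq_top_iff, EReal.toENNReal_eq_top_iff]
  exact EReal.coe_ne_top x

/-- The barrier is finite only on its domain. -/
theorem qeBarrier_eq_top {n : ℕ} {t : ℝ} {X : SymMat n}
    (h : ¬((∀ i, 0 < X.isHermitian.eigenvalues i) ∧
      ∑ i, X.isHermitian.eigenvalues i * Real.log (X.isHermitian.eigenvalues i) < t)) :
    qeBarrier t X = ⊤ := by
  have key : extLn ((t : EReal) - qe X) = ⊥ ∨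
      (extLn ((t : EReal) - qe X) ≠ ⊤ ∧
        extLn (((X : Matrix (Fin n) (Fin n) ℝ).det : ℝ) : EReal) = ⊥) := by
    by_cases hneg : ∃ i, X.isHermitian.eigenvalues i < 0
    · obtain ⟨i, hi⟩ := hneg
      left
      rw [qe_of_neg hi, EReal.sub_top]
      exact extLn_of_nonpos bot_le
    push Not at hneg
    rw [qe_of_nonneg hneg, ← EReal.coe_sub]
    by_cases hpos : ∀ i, 0 < X.isHermitian.eigenvalues i
    · left
      refine extLn_of_nonpos ?_
      have : ¬ _ := fun ht => h ⟨hpos, ht⟩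
      exact_mod_cast sub_nonpos.mpr (not_lt.mp this)
    · right
      refine ⟨extLn_coe_ne_top _, extLn_of_nonpos ?_⟩
      push Not at hpos
      obtain ⟨i, hi⟩ := hpos
      have hdet : (X : Matrix (Fin n) (Fin n) ℝ).det = 0 := by
        rw [X.isHermitian.det_eq_prod_eigenvalues]
        exact Finset.prod_eq_zero (Finset.mem_univ i) (le_antisymm hi (hneg i))
      simp [hdet]
  rw [qeBarrier]
  rcases key with h₁ | ⟨h₁, h₂⟩
  · rw [h₁, EReal.neg_bot]
    exact EReal.top_sub (extLn_coe_ne_top _)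
  · rw [h₂, sub_eq_add_neg, EReal.neg_bot]
    exact EReal.add_top_of_ne_bot fun hb => h₁ (EReal.neg_eq_bot_iff.mp hb)

/-! ### The scalar conjugates -/

theorem theta_pos (r : ℝ) : 0 < theta r := (theta_spec r).1

theorem one_div_theta_sub_log (r : ℝ) : 1 / theta r - Real.log (theta r) = r := (theta_spec r).2

/-- Fenchel–Young inequality for `d ↦ -ln d`. -/
theorem mul_add_log_le {η d : ℝ} (hη : η < 0) (hd : 0 < d) :
    η * d + Real.log d ≤ -1 - Real.log (-η) := by
  have h := Real.log_le_sub_one_of_pos (mul_pos (neg_pos.mpr hη) hd)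
  rw [Real.log_mul (neg_pos.mpr hη).ne' hd.ne'] at h
  linarith

/-- Fenchel–Young inequality for `x ↦ -η x ln x - ln x`, at `y = η (r - 1 + ln (-η))`. -/
theorem fenchelYoung_theta {η x : ℝ} (hη : η < 0) (hx : 0 < x) (r : ℝ) :
    η * (x * r) - η * (1 - Real.log (-η)) * x + η * (x * Real.log x) + Real.log x ≤
      theta r + 1 / theta r - (r - (1 - Real.log (-η))) - 2 := by
  have hθ := theta_pos r
  have hr := one_div_theta_sub_log r
  set θ := theta r
  have hη' := neg_pos.mpr hη
  have hu : 0 < -η * x / θ := div_pos (mul_pos hη' hx) hθ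
  have hlog : Real.log (-η * x / θ) = Real.log (-η) + Real.log x - Real.log θ := by
    rw [Real.log_div (mul_pos hη' hx).ne' hθ.ne', Real.log_mul hη'.ne' hx.ne']
  have h₁ := Real.log_le_sub_one_of_pos hu
  have h₂ := mul_le_mul_of_nonneg_left (Real.one_sub_inv_le_log_of_pos hu)
    (mul_pos hη' hx).le
  have h₃ : -η * x * (1 - (-η * x / θ)⁻¹) = -η * x - θ := by
    have := hη.ne
    field_simp
    ring
  rw [h₃, hlog] at h₂
  rw [hlog] at h₁
  have h₄ : -η * x / θ = -η * x * (r + Real.log θ) := by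
    rw [← hr]; ring
  have h₅ : 1 / θ = r + Real.log θ := by linarith
  rw [h₄] at h₁
  rw [h₅]
  nlinarith [h₁, h₂]

/-- Equality holds in `fenchelYoung_theta` at `x = -θ(r) / η`. -/
theorem fenchelYoung_theta_eq {η : ℝ} (hη : η < 0) (r : ℝ) :
    η * (-1 / η * theta r * r) - η * (1 - Real.log (-η)) * (-1 / η * theta r) +
        η * (-1 / η * theta r * Real.log (-1 / η * theta r)) + Real.log (-1 / η * theta r) =
      theta r + 1 / theta r - (r - (1 - Real.log (-η))) - 2 := by
  have hθ := theta_pos r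
  have hr := one_div_theta_sub_log r
  set θ := theta r
  have hη' := neg_pos.mpr hη
  have hlog : Real.log (-1 / η * θ) = Real.log θ - Real.log (-η) := by
    rw [show -1 / η * θ = θ / -η by have := hη.ne; field_simp, Real.log_div hθ.ne' hη'.ne']
  have h₀ : ∀ a : ℝ, η * (-1 / η * θ * a) = -θ * a := fun a => by
    have := hη.ne; field_simp
  have h₁ : η * (1 - Real.log (-η)) * (-1 / η * θ) = -θ * (1 - Real.log (-η)) := by
    rw [← h₀]; ring
  have hθ' : θ * (1 / θ) = 1 := by field_simp
  have h₅ : Real.log θ = 1 / θ - r := by linarith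
  rw [h₀, h₀, h₁, hlog, h₅]
  linear_combination -hθ'

/-! ### The conjugate of the barrier -/

/-- The trace inequality behind the Fenchel–Young inequality of the barrier, for a scalar
inequality between functions of the eigenvalues. -/
theorem trace_mul_add_sum_le {n : ℕ} (X Z : SymMat n) {c : ℝ} {h k : ℝ → ℝ}
    (hhk : ∀ i j, c * (X.isHermitian.eigenvalues i * Z.isHermitian.eigenvalues j) +
      h (X.isHermitian.eigenvalues i) ≤ k (Z.isHermitian.eigenvalues j)) :
    c * ((X : Matrix (Fin n) (Fin n) ℝ) * (Z : Matrix (Fin n) (Fin n) ℝ)).trace +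
        ∑ i, h (X.isHermitian.eigenvalues i) ≤ ∑ j, k (Z.isHermitian.eigenvalues j) := by
  obtain ⟨W, hW, htr⟩ := exists_doublyStochastic_trace_mul X Z
  obtain ⟨hW₀, hrow, hcol⟩ := mem_doublyStochastic_iff_sum.mp hW
  set l := X.isHermitian.eigenvalues
  set z := Z.isHermitian.eigenvalues
  calc c * ((X : Matrix (Fin n) (Fin n) ℝ) * (Z : Matrix (Fin n) (Fin n) ℝ)).trace + ∑ i, h (l i)
      = c * (∑ i, ∑ j, W i j * (l i * z j)) + ∑ i, (∑ j, W i j) * h (l i) := by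
        simp only [htr, hrow, one_mul]
    _ = ∑ i, ∑ j, W i j * (c * (l i * z j) + h (l i)) := by
        simp only [Finset.mul_sum, Finset.sum_mul, ← Finset.sum_add_distrib]
        refine Finset.sum_congr rfl fun i _ => Finset.sum_congr rfl fun j _ => ?_
        ring
    _ ≤ ∑ i, ∑ j, W i j * k (z j) :=
        Finset.sum_le_sum fun i _ => Finset.sum_le_sum fun j _ =>
          mul_le_mul_of_nonneg_left (hhk i j) (hW₀ i j)
    _ = ∑ j, k (z j) := by
        rw [Finset.sum_comm]
        simp only [← Finset.sum_mul, hcol, one_mul]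

theorem matExt_theta_mul_inv {n : ℕ} (Z : SymMat n) :
    matExt theta Z * matExt (fun x => 1 / theta x) Z = 1 := by
  rw [matExt_mul, ← matExt_one Z]
  simp only [mul_one_div_cancel (theta_pos _).ne']

theorem trace_eq_sum_eigenvalues {n : ℕ} (X : SymMat n) :
    (X : Matrix (Fin n) (Fin n) ℝ).trace = ∑ i, X.isHermitian.eigenvalues i := by
  rw [← trace_matExt (fun x => x), matExt_id]

/-- The pairing with `Y` in terms of the shifted matrix `Z = Y / η + a I`. -/
theorem trace_mul_eq_of_shift {n : ℕ} {η a : ℝ} (hη : η ≠ 0) (X Y : SymMat n) :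
    ((X : Matrix (Fin n) (Fin n) ℝ) * (Y : Matrix (Fin n) (Fin n) ℝ)).trace =
      η * ((X : Matrix (Fin n) (Fin n) ℝ) *
        (((1 / η) • Y + a • (1 : SymMat n) : SymMat n) : Matrix (Fin n) (Fin n) ℝ)).trace -
        η * a * ∑ i, X.isHermitian.eigenvalues i := by
  rw [← trace_eq_sum_eigenvalues]
  simp [Matrix.mul_add, Matrix.trace_add, Matrix.trace_smul]
  field_simp
  ring

theorem trace_smul_eq_of_shift {n : ℕ} (b a : ℝ) (Y : SymMat n) :
    (b • (Y : Matrix (Fin n) (Fin n) ℝ)).trace =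
      ∑ j, ((b • Y + a • (1 : SymMat n) : SymMat n).isHermitian.eigenvalues j - a) := by
  rw [Finset.sum_sub_distrib, ← trace_eq_sum_eigenvalues]
  simp [Matrix.trace_add, Matrix.trace_smul, mul_comm]

theorem mainTheorem2 (n : ℕ) (η : ℝ) (hη : η < 0) (Y : SymMat n) :
    IsUnit (bigTheta η Y) ∧
    lfConj qeBarrier η Y =
      ((-Real.log (-η) + (bigTheta η Y + (bigTheta η Y)⁻¹).trace
        - ((1 / η) • (Y : Matrix (Fin n) (Fin n) ℝ)).trace - 1 - 2 * (n : ℝ) : ℝ) : EReal) := by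
  have hshift := fun X => trace_mul_eq_of_shift (a := 1 - Real.log (-η)) hη.ne X Y
  have hY := trace_smul_eq_of_shift (1 / η) (1 - Real.log (-η)) Y
  rw [bigTheta, hY]
  set Z : SymMat n := (1 / η) • Y + (1 - Real.log (-η)) • (1 : SymMat n)
  have hinv := matExt_theta_mul_inv Z
  refine ⟨IsUnit.of_mul_eq_one _ hinv, ?_⟩
  set z := Z.isHermitian.eigenvalues
  have hval : -Real.log (-η) + (matExt theta Z + (matExt theta Z)⁻¹).trace
      - ∑ j, (z j - (1 - Real.log (-η))) - 1 - 2 * (n : ℝ) =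
      -1 - Real.log (-η) +
        ∑ j, (theta (z j) + 1 / theta (z j) - (z j - (1 - Real.log (-η))) - 2) := by
    rw [Matrix.inv_eq_right_inv hinv, Matrix.trace_add, trace_matExt, trace_matExt]
    simp only [Finset.sum_sub_distrib, Finset.sum_add_distrib, Finset.sum_const,
      Finset.card_univ, Fintype.card_fin, nsmul_eq_mul]
    ring
  rw [hval]
  apply le_antisymm
  · refine iSup₂_le fun t X => ?_
    by_cases hdom : (∀ i, 0 < X.isHermitian.eigenvalues i) ∧
        ∑ i, X.isHermitian.eigenvalues i * Real.log (X.isHermitian.eigenvalues i) < t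
    · obtain ⟨hX, ht⟩ := hdom
      rw [qeBarrier_of_pos hX ht, ← EReal.coe_sub, EReal.coe_le_coe_iff, hshift]
      have h₁ := mul_add_log_le hη (sub_pos.mpr ht)
      have h₂ := trace_mul_add_sum_le X Z (c := η)
        (h := fun x => -(η * (1 - Real.log (-η)) * x) + η * (x * Real.log x) + Real.log x)
        (k := fun r => theta r + 1 / theta r - (r - (1 - Real.log (-η))) - 2)
        (fun i j => by linarith [fenchelYoung_theta hη (hX i) (Z.isHermitian.eigenvalues j)])
      simp only [Finset.sum_add_distrib, Finset.sum_neg_distrib, ← Finset.mul_sum] at h₂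
      linarith
    · rw [qeBarrier_eq_top hdom, EReal.sub_top]
      exact bot_le
  · have hc : 0 < -1 / η := div_pos_of_neg_of_neg (by norm_num) hη
    set X : SymMat n := symMatExt (fun x => -1 / η * theta x) Z with hXdef
    have hX : ∀ i, 0 < X.isHermitian.eigenvalues i :=
      eigenvalues_symMatExt_pos (fun x => mul_pos hc (theta_pos x)) Z
    set q := ∑ i, X.isHermitian.eigenvalues i * Real.log (X.isHermitian.eigenvalues i) with hq
    refine le_trans (le_of_eq ?_) (le_iSup₂ (q + -1 / η) X)
    rw [qeBarrier_of_pos hX (lt_add_of_pos_right _ hc), ← EReal.coe_sub, EReal.coe_eq_coe_iff,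
      hshift, ← hq, add_sub_cancel_left]
    have htr : ((X : Matrix (Fin n) (Fin n) ℝ) * (Z : Matrix (Fin n) (Fin n) ℝ)).trace =
        ∑ j, -1 / η * theta (z j) * z j := by
      conv_lhs => rw [← matExt_id Z]
      rw [← trace_matExt (fun x => -1 / η * theta x * x), ← matExt_mul]
      rfl
    have hsum := fun g => sum_eigenvalues_symMatExt (fun x => -1 / η * theta x) g Z
    have hlog : Real.log (-1 / η) = -Real.log (-η) := by
      rw [← Real.log_inv]; congr 1; have := hη.ne; field_simp
    have hηη : η * (-1 / η) = -1 := by have := hη.ne; field_simp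
    rw [htr, hq, hsum (fun x => x * Real.log x), hsum Real.log, hsum (fun x => x), hlog,
      ← Finset.sum_congr rfl fun j _ => fenchelYoung_theta_eq hη (z j)]
    simp only [Finset.sum_add_distrib, Finset.sum_sub_distrib, ← Finset.mul_sum _ _ η,
      ← Finset.mul_sum _ _ (η * (1 - Real.log (-η)))]
    linear_combination -hηη
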